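/- For $\beta_1,\beta_2\in(0,1)$ let $F=F_{\beta_1,\beta_2}$ be the self-map of the unit square $[0,1]\times[0,1]$ given by $F(x,y)=(2x,\,g_1(y))$ if $0\le x\le 1/2$ and $F(x,y)=(2x-1,\,g_2(y))$ if $1/2<x\le 1$, where $$g_1(y)=y+y(1-y)(y-\beta_1),\qquad g_2(y)=y-y(1-y)(y-\beta_2).$$ Put $A_0=[0,1]\times\{0\}$ and $A_1=[0,1]\times\{1\}$, and let $m$ be Lebesgue measure on the square. For a set $A$, let the basin $\mathcal B(A)$ be the set of points whose $\omega$-limit set under $F$ is contained in $A$. A compact set $A$ with $F(A)=A$ is called - a *Milnor attractor* if $m(\mathcal B(A))>0$ and no compact proper subset $A'\subsetneq A$ has a basin $\mathcal B(A')$ that equals $\mathcal B(A)$ up to an $m$-null set; - an *essential attractor* if $\lim_{\delta\to0^+} m(B_\delta(A)\cap\mathcal B(A))/m(B_\delta(A))=1$, where $B_\delta(A)$ is the $\delta$-neighbourhood of $A$ in the square; - a *chaotic saddle* if some $x\in A$ has $\omega(x)=A$, $\mathcal B(A)\cap U\ne\emptyset$ for some neighbourhood $U$ of $A$, and $m(\mathcal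 B(A))=0$. A Milnor attractor $A$ *has a locally riddled basin* if there is a neighbourhood $U$ of $A$ such that $m\big(B_\varepsilon(p)\setminus\bigcap_{n\ge0}F^{-n}(U)\big)>0$ for all $p\in A$ and $\varepsilon>0$. Then the following hold. (a) If $\beta_1>1/2$, or if $\beta_1\le 1/2$ and $\beta_2<\frac{1}{1-\beta_1}-1$, then $A_0$ is a Milnor attractor and an essential attractor, and it has a locally riddled basin. (b) If $\beta_1<1/2$, or if $\beta_1\ge 1/2$ and $\beta_2>2-\frac{1}{\beta_1}$, then $A_1$ is a Milnor attractor and an essential attractor, and it has a locally riddled basin. (c) If $\beta_1<1/2$ and $\beta_2>\frac{1}{1-\beta_1}-1$, then $A_0$ is a chaotic saddle. (d) If $\beta_1>1/2$ and $\beta_2<2-\frac{1}{\beta_1}$, then $A_1$ is a chaotic saddle. -/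

import Mathlib

open Set Filter Topology MeasureTheory

namespace RiddledBasin

section General

variable {X : Type*} [MetricSpace X]

/-- The `ω`-limit set of a point: all limit points of the sequence `F^n x`, `n ≥ 0`. -/
def omegaSet (F : X → X) (x : X) : Set X :=
  omegaLimit atTop (fun (n : ℕ) (z : X) => F^[n] z) {x}

/-- The basin of attraction of `A`: all points whose `ω`-limit set is contained in `A`. -/
def basin (F : X → X) (A : Set X) : Set X :=
  {x | omegaSet F x ⊆ A}

/-- `A` is a compact set with `F(A) = A`. -/
structure IsCompactInvariant (F : X → X) (A : Set X) : Prop where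
  isCompact : IsCompact A
  image_eq : F '' A = A

/-- Some point of `A` has `A` as its `ω`-limit set. -/
def IsTransitiveSet (F : X → X) (A : Set X) : Prop :=
  ∃ x ∈ A, omegaSet F x = A

variable [MeasurableSpace X]

/-- Milnor attractor: the basin is not a null set, and no compact proper subset of `A` has the
same basin up to a null set. -/
structure IsMilnorAttractor (F : X → X) (m : Measure X) (A : Set X) : Prop
    extends IsCompactInvariant F A where
  measure_basin_ne_zero : m (basin F A) ≠ 0
  minimal : ∀ A' : Set X, IsCompact A' → A' ⊂ A → ¬ (basin F A' =ᵐ[m] basin F A)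

/-- Essential attractor: the proportion of the `δ`-neighbourhood of `A` that lies in the basin
tends to `1` as `δ → 0`. -/
structure IsEssentialAttractor (F : X → X) (m : Measure X) (A : Set X) : Prop
    extends IsCompactInvariant F A where
  tendsto_density : Tendsto
    (fun δ : ℝ => m (Metric.thickening δ A ∩ basin F A) / m (Metric.thickening δ A))
    (𝓝[>] 0) (𝓝 1)

/-- A Milnor attractor `A` has a locally riddled basin if, for some neighbourhood `U` of `A`,
every ball centred at a point of `A` contains a set of positive measure of points
whose forward orbit does not stay in `U`. -/
structure HasLocallyRiddledBasin (F : X → X) (m : Measure X) (A : Set X) : Prop where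
  isMilnorAttractor : IsMilnorAttractor F m A
  riddled : ∃ U ∈ 𝓝ˢ A, ∀ x ∈ A, ∀ ε : ℝ, 0 < ε →
    0 < m (Metric.ball x ε ∩ (⋂ n : ℕ, F^[n] ⁻¹' U)ᶜ)

/-- Chaotic saddle: a compact invariant transitive set whose basin meets some neighbourhood `U`
of `A` but is a null set. -/
structure IsChaoticSaddle (F : X → X) (m : Measure X) (A : Set X) : Prop
    extends IsCompactInvariant F A where
  isTransitiveSet : IsTransitiveSet F A
  basin_inter_nonempty : ∃ U ∈ 𝓝ˢ A, (basin F A ∩ U).Nonempty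
  measure_basin_eq_zero : m (basin F A) = 0

end General

/-- The phase space: the unit square. Its `volume` is Lebesgue measure (of total mass `1`). The
metric is the maximum metric; it has the same `δ`-neighbourhoods of the horizontal sides as the
Euclidean metric, and every ball of either metric contains a concentric ball of the other. -/
abbrev Square : Type := unitInterval × unitInterval

/-- The doubling map of the unit interval, with the value `1` at `1 / 2` and at `1`. -/
noncomputable def doubling (x : unitInterval) : unitInterval :=
  if h : (x : ℝ) ≤ 1 / 2 then
    ⟨2 * (x : ℝ), by have := x.2.1; constructor <;> linarith⟩
  else
    ⟨2 * (x : ℝ) - 1, by have := x.2.2; push Not at h; constructor <;> linarith⟩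

/-- The first cubic fiber map, for a parameter in `(0, 1)`. -/
def fiberOne (β : ℝ) (hβ : β ∈ Ioo (0 : ℝ) 1) (y : unitInterval) : unitInterval :=
  ⟨(y : ℝ) + (y : ℝ) * (1 - (y : ℝ)) * ((y : ℝ) - β), by
    obtain ⟨y, h0, h1⟩ := y
    obtain ⟨hb0, hb1⟩ := hβ
    have h2 : 0 ≤ y * (1 - y) := mul_nonneg h0 (by linarith)
    constructor
    · show 0 ≤ y + y * (1 - y) * (y - β)
      nlinarith [mul_nonneg h2 h0, mul_nonneg h2 (sub_nonneg.2 hb1.le), sq_nonneg y]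
    · show y + y * (1 - y) * (y - β) ≤ 1
      nlinarith [mul_nonneg h2 hb0.le, mul_nonneg h2 (sub_nonneg.2 h1), sq_nonneg (1 - y)]⟩

/-- The second cubic fiber map, for a parameter in `(0, 1)`. -/
def fiberTwo (β : ℝ) (hβ : β ∈ Ioo (0 : ℝ) 1) (y : unitInterval) : unitInterval :=
  ⟨(y : ℝ) - (y : ℝ) * (1 - (y : ℝ)) * ((y : ℝ) - β), by
    obtain ⟨y, h0, h1⟩ := y
    obtain ⟨hb0, hb1⟩ := hβ
    have h2 : 0 ≤ y * (1 - y) := mul_nonneg h0 (by linarith)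
    constructor
    · show 0 ≤ y - y * (1 - y) * (y - β)
      nlinarith [mul_nonneg h2 hb0.le, mul_nonneg h2 (sub_nonneg.2 h1), sq_nonneg y]
    · show y - y * (1 - y) * (y - β) ≤ 1
      nlinarith [mul_nonneg h2 h0, mul_nonneg h2 (sub_nonneg.2 hb1.le), sq_nonneg (1 - y)]⟩

/-- The skew product of the square over the doubling map: the fiber over `x` is moved by the first
fiber map when `x ≤ 1 / 2`, and by the second one when `x > 1 / 2`. -/
noncomputable def skewProduct (β₁ β₂ : ℝ) (h₁ : β₁ ∈ Ioo (0 : ℝ) 1) (h₂ : β₂ ∈ Ioo (0 : ℝ) 1)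
    (p : Square) : Square :=
  (doubling p.1, if (p.1 : ℝ) ≤ 1 / 2 then fiberOne β₁ h₁ p.2 else fiberTwo β₂ h₂ p.2)

/-- The side `[0, 1] × {0}` of the square. -/
def bottomSide : Set Square := {p | p.2 = 0}

/-- The side `[0, 1] × {1}` of the square. -/
def topSide : Set Square := {p | p.2 = 1}

end RiddledBasin

namespace RiddledBasin

/-! Everything is decided by the transverse Lyapunov exponent of a side. Near `y = 0` the two fiber
maps act like multiplication by `1 - β₁` and by `1 + β₂`. By the strong law for binary digits,
almost every doubling orbit uses each half with frequency `1 / 2`, so the exponent is half of `log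
((1 - β₁) * (1 + β₂))`. The parameter conditions for the bottom side put this product below or above
`1`.

Below `1`, the fiber over almost every `x` starts with a segment attracted to the side
(`ae_exists_segment_subset_basin`), which gives density one and hence a basin of positive measure.
Minimality comes from ergodicity: almost every doubling orbit is dense, so the `ω`-limit set of
almost every basin point is the whole side. Riddling is purely topological: every dyadic interval
contains an interval of points whose later digits form a long run of ones; the side repels there,
and an open rectangle escapes (`measure_ball_inter_escape_pos`).

Above `1`, an orbit off the side but converging to it would eventually grow exponentially, which is
absurd (`ae_forall_notMem_basin`).

The reflection `y ↦ 1 - y` turns the parameters into `1 - β₁` and `1 - β₂`, so the top side needs no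
separate analysis. -/

/-- Under an ergodic map, almost every orbit visits a given set of positive measure infinitely
often. -/
theorem ae_frequently_mem_of_ergodic {α : Type*} [MeasurableSpace α] {μ : Measure α}
    [IsFiniteMeasure μ] {f : α → α} (hf : Ergodic f μ) {s : Set α} (hs : MeasurableSet s)
    (h0 : μ s ≠ 0) : ∀ᵐ x ∂μ, ∃ᶠ n in atTop, f^[n] x ∈ s := by
  have hB : MeasurableSet {x | ∃ᶠ n in atTop, f^[n] x ∈ s} := by
    have : {x | ∃ᶠ n in atTop, f^[n] x ∈ s} = ⋂ N : ℕ, ⋃ n : ℕ, ⋃ _ : N ≤ n, f^[n] ⁻¹' s := by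
      ext x; simp [frequently_atTop]
    rw [this]
    exact MeasurableSet.iInter fun N => MeasurableSet.iUnion fun n => MeasurableSet.iUnion
      fun _ => (hf.measurable.iterate n) hs
  have hinv : f ⁻¹' {x | ∃ᶠ n in atTop, f^[n] x ∈ s} = {x | ∃ᶠ n in atTop, f^[n] x ∈ s} := by
    ext x
    simp only [mem_preimage, mem_ofPred_eq, ← Function.iterate_succ_apply]
    rw [frequently_atTop, frequently_atTop]
    constructor
    · intro h N
      obtain ⟨n, hn, hx⟩ := h N
      exact ⟨n + 1, by omega, hx⟩
    · intro h N
      obtain ⟨n, hn, hx⟩ := h (N + 1)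
      obtain ⟨k, rfl⟩ : ∃ k, n = k + 1 := ⟨n - 1, by omega⟩
      exact ⟨k, by omega, hx⟩
  rcases hf.toPreErgodic.ae_mem_or_ae_notMem hB hinv with h | h
  · exact h
  -- If almost no point visited `s` infinitely often, Poincaré recurrence would make `s` null.
  · exfalso
    apply h0
    rw [measure_eq_zero_iff_ae_notMem]
    filter_upwards [h, hf.toMeasurePreserving.conservative.ae_mem_imp_frequently_image_mem
      hs.nullMeasurableSet] with x h1 h2 h3
    exact h1 (h2 h3)

/-! ### The doubling map and Lebesgue measure -/

theorem coe_doubling_of_le {x : unitInterval} (h : (x : ℝ) ≤ 1 / 2) :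
    (doubling x : ℝ) = 2 * x := by
  simp only [doubling, dif_pos h]

theorem coe_doubling_of_lt {x : unitInterval} (h : 1 / 2 < (x : ℝ)) :
    (doubling x : ℝ) = 2 * x - 1 := by
  simp only [doubling, dif_neg (not_le.2 h)]

theorem measurableSet_leftHalf : MeasurableSet {x : unitInterval | (x : ℝ) ≤ 1 / 2} :=
  measurableSet_le measurable_subtype_coe measurable_const

theorem measurable_doubling : Measurable doubling := by
  have : Measurable fun x : unitInterval =>
      if (x : ℝ) ≤ 1 / 2 then 2 * (x : ℝ) else 2 * (x : ℝ) - 1 :=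
    Measurable.ite measurableSet_leftHalf (by fun_prop) (by fun_prop)
  refine unitInterval.measurableEmbedding_coe.measurable_comp_iff.1 ?_
  convert this using 2 with x
  split_ifs with h
  · exact coe_doubling_of_le h
  · exact coe_doubling_of_lt (not_le.1 h)

/-- The left branch is a scaling by `2` onto the interval. Together with its right-hand counterpart
this gives both the invariance of Lebesgue measure and the independence of the first digit from the
later ones. -/
theorem volume_leftHalf_inter_preimage (T : Set unitInterval) :
    volume ({x : unitInterval | (x : ℝ) ≤ 1 / 2} ∩ doubling ⁻¹' T) = volume T / 2 := by
  have h : ((↑) : unitInterval → ℝ) '' ({x : unitInterval | (x : ℝ) ≤ 1 / 2} ∩ doubling ⁻¹' T)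
      = (fun x : ℝ => 2 * x) ⁻¹' (((↑) : unitInterval → ℝ) '' T) := by
    ext x
    constructor
    · rintro ⟨y, ⟨hy, hyT⟩, rfl⟩
      exact ⟨doubling y, hyT, coe_doubling_of_le hy⟩
    · rintro ⟨y, hy, hyx⟩
      have hyx : (y : ℝ) = 2 * x := hyx
      have h0 := y.2.1
      have h1 := y.2.2
      have hx : x ∈ Icc (0 : ℝ) 1 := ⟨by linarith, by linarith⟩
      have hx2 : ((⟨x, hx⟩ : unitInterval) : ℝ) ≤ 1 / 2 := by show x ≤ 1 / 2; linarith
      refine ⟨⟨x, hx⟩, ⟨hx2, ?_⟩, rfl⟩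
      have : doubling ⟨x, hx⟩ = y := Subtype.ext (by rw [coe_doubling_of_le hx2, hyx])
      rw [mem_preimage, this]; exact hy
  rw [unitInterval.volume_apply, h, Real.volume_preimage_mul_left two_ne_zero,
    ← unitInterval.volume_apply, div_eq_mul_inv, mul_comm]
  congr 1
  rw [abs_of_pos (by norm_num), ENNReal.ofReal_inv_of_pos (by norm_num)]; simp

theorem volume_rightHalf_inter_preimage (T : Set unitInterval) :
    volume ({x : unitInterval | (x : ℝ) ≤ 1 / 2}ᶜ ∩ doubling ⁻¹' T) = volume T / 2 := by
  -- The point `0` is removed from `T` because the right branch only takes values in `(0, 1]`: the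
  -- point `1 / 2` belongs to the left half.
  have h : ((↑) : unitInterval → ℝ) ''
      ({x : unitInterval | (x : ℝ) ≤ 1 / 2}ᶜ ∩ doubling ⁻¹' T)
      = (fun x : ℝ => 2 * x) ⁻¹' ((fun x : ℝ => x + (-1)) ⁻¹'
        (((↑) : unitInterval → ℝ) '' (T \ {0}))) := by
    ext x
    constructor
    · rintro ⟨y, ⟨hy, hyT⟩, rfl⟩
      have hy : 1 / 2 < (y : ℝ) := not_le.1 hy
      refine ⟨doubling y, ⟨hyT, ?_⟩, coe_doubling_of_lt hy⟩
      intro h0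
      have h1 := coe_doubling_of_lt hy
      rw [mem_singleton_iff.1 h0] at h1
      simp at h1
      linarith
    · rintro ⟨y, ⟨hy, hy0⟩, hyx⟩
      have hyx : (y : ℝ) = 2 * x + (-1) := hyx
      have h0 : 0 < (y : ℝ) := unitInterval.pos_iff_ne_zero.2 hy0
      have h1 := y.2.2
      have hx : x ∈ Icc (0 : ℝ) 1 := ⟨by linarith, by linarith⟩
      have hx2 : 1 / 2 < ((⟨x, hx⟩ : unitInterval) : ℝ) := by show 1 / 2 < x; linarith
      refine ⟨⟨x, hx⟩, ⟨not_le.2 hx2, ?_⟩, rfl⟩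
      have : doubling ⟨x, hx⟩ = y := Subtype.ext (by rw [coe_doubling_of_lt hx2, hyx]; ring)
      rw [mem_preimage, this]; exact hy
  rw [unitInterval.volume_apply, h, Real.volume_preimage_mul_left two_ne_zero,
    measure_preimage_add_right,
    ← unitInterval.volume_apply, measure_sdiff_null (measure_singleton _), div_eq_mul_inv, mul_comm]
  congr 1
  rw [abs_of_pos (by norm_num), ENNReal.ofReal_inv_of_pos (by norm_num)]; simp

theorem measurePreserving_doubling : MeasurePreserving doubling volume volume := by
  refine ⟨measurable_doubling, ?_⟩
  ext T hT
  rw [Measure.map_apply measurable_doubling hT,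
    ← measure_inter_add_sdiff (doubling ⁻¹' T) measurableSet_leftHalf, inter_comm, sdiff_eq,
    inter_comm (doubling ⁻¹' T), volume_leftHalf_inter_preimage,
    volume_rightHalf_inter_preimage, ENNReal.add_halves]

/-! ### Density of almost every doubling orbit -/

/-- The projection of the unit interval to the circle. -/
noncomputable def toCircle (x : unitInterval) : AddCircle (1 : ℝ) := ((x : ℝ) : AddCircle (1 : ℝ))

theorem measurePreserving_toCircle : MeasurePreserving toCircle volume volume := by
  have h1 := unitInterval.measurePreserving_coe
  have h2 := AddCircle.measurePreserving_mk (1 : ℝ) 0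
  rw [zero_add, restrict_Ioc_eq_restrict_Icc] at h2
  exact h2.comp h1

theorem toCircle_doubling (x : unitInterval) : toCircle (doubling x) = 2 • toCircle x := by
  unfold toCircle
  rw [← AddCircle.coe_nsmul]
  by_cases h : (x : ℝ) ≤ 1 / 2
  · rw [coe_doubling_of_le h]; simp
  · rw [coe_doubling_of_lt (not_le.1 h), ← AddCircle.coe_add_period]; simp

theorem toCircle_iterate_doubling (n : ℕ) (x : unitInterval) :
    toCircle (doubling^[n] x) = (fun θ : AddCircle (1 : ℝ) => 2 • θ)^[n] (toCircle x) :=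
  (Function.Semiconj.iterate_right (f := toCircle) (ga := doubling)
    (gb := fun θ : AddCircle (1 : ℝ) => 2 • θ) toCircle_doubling n) x

/-- The projection to the circle semiconjugates the doubling map to `θ ↦ 2 • θ`, whose ergodicity is
pulled back. Cutting `O` down to `Ioo 0 1` avoids the point where the endpoints are glued. -/
theorem ae_frequently_doubling_mem {O : Set ℝ} (hO : IsOpen O) (h : (O ∩ Ioo 0 1).Nonempty) :
    ∀ᵐ x : unitInterval, ∃ᶠ n in atTop, ((doubling^[n] x : unitInterval) : ℝ) ∈ O := by
  have hW : IsOpen (((↑) : ℝ → AddCircle (1 : ℝ)) '' (O ∩ Ioo 0 1)) :=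
    QuotientAddGroup.isOpenMap_coe _ (hO.inter isOpen_Ioo)
  have herg : Ergodic fun θ : AddCircle (1 : ℝ) => 2 • θ := AddCircle.ergodic_nsmul one_lt_two
  have hae := ae_frequently_mem_of_ergodic herg hW.measurableSet
    (hW.measure_ne_zero volume (h.image _))
  filter_upwards [measurePreserving_toCircle.quasiMeasurePreserving.ae hae] with x hx
  refine hx.mono fun n hn => ?_
  rw [← toCircle_iterate_doubling] at hn
  obtain ⟨w, ⟨hwO, hw⟩, hwe⟩ := hn
  have h0 : ((w - (doubling^[n] x : unitInterval) : ℝ) : AddCircle (1 : ℝ)) = 0 := by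
    rw [AddCircle.coe_sub, hwe]; exact sub_self _
  obtain ⟨k, hk⟩ := AddCircle.coe_eq_zero_iff (1 : ℝ) |>.1 h0
  have hk : (k : ℝ) = w - (doubling^[n] x : unitInterval) := by simpa using hk
  have h1 := (doubling^[n] x).2.1
  have h2 := (doubling^[n] x).2.2
  -- Since `w` is in the open interval and the orbit point in the closed one, their integer
  -- difference is strictly between `-1` and `1`.
  have hk0 : k = 0 := by
    have h3 : (-1 : ℝ) < k := by rw [hk]; linarith [hw.1]
    have h4 : (k : ℝ) < 1 := by rw [hk]; linarith [hw.2]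
    have h3 : (-1 : ℤ) < k := by exact_mod_cast h3
    have h4 : k < 1 := by exact_mod_cast h4
    omega
  rw [hk0] at hk
  have : w = (doubling^[n] x : unitInterval) := by push_cast at hk; linarith
  rwa [← this]

/-- Almost every orbit of the doubling map accumulates at every point of the interval. -/
theorem ae_forall_mapClusterPt_doubling :
    ∀ᵐ x : unitInterval, ∀ z : unitInterval, MapClusterPt z atTop fun n => doubling^[n] x := by
  have h : ∀ᵐ x : unitInterval, ∀ a b : ℚ, (Ioo (a : ℝ) b ∩ Ioo 0 1).Nonempty →
      ∃ᶠ n in atTop, ((doubling^[n] x : unitInterval) : ℝ) ∈ Ioo (a : ℝ) b := by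
    simp only [ae_all_iff]
    exact fun a b hab => ae_frequently_doubling_mem isOpen_Ioo hab
  filter_upwards [h] with x hx z
  rw [mapClusterPt_iff_frequently]
  intro s hs
  obtain ⟨ε, hε, hs⟩ := Metric.mem_nhds_iff.1 hs
  obtain ⟨a, ha1, ha2⟩ := exists_rat_btwn (show (z : ℝ) - ε < z by linarith)
  obtain ⟨b, hb1, hb2⟩ := exists_rat_btwn (show (z : ℝ) < z + ε by linarith)
  have hz0 := z.2.1
  have hz1 := z.2.2
  have hne : (Ioo (a : ℝ) b ∩ Ioo 0 1).Nonempty := by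
    rw [Ioo_inter_Ioo, nonempty_Ioo]
    simp only [sup_lt_iff, lt_inf_iff]
    exact ⟨⟨by linarith, by linarith⟩, by linarith, by norm_num⟩
  refine (hx a b hne).mono fun n hn => hs ?_
  rw [Metric.mem_ball, Subtype.dist_eq, Real.dist_eq, abs_lt]
  constructor <;> linarith [hn.1, hn.2]

/-! ### The law of large numbers for binary digits -/

/-- The strong law of large numbers for the binary digits: if each passage of an orbit of the
doubling map through the left half counts `a` and each passage through the right half counts `b`,
then almost surely the mean is `(a + b) / 2`. -/
theorem ae_tendsto_average_doubling (a b : ℝ) :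
    ∀ᵐ x : unitInterval, Tendsto (fun n : ℕ => (∑ i ∈ Finset.range n,
      if ((doubling^[i] x : unitInterval) : ℝ) ≤ 1 / 2 then a else b) / n) atTop
      (𝓝 ((a + b) / 2)) := by
  set φ : unitInterval → ℝ := fun x => if (x : ℝ) ≤ 1 / 2 then a else b with hφ
  have hφm : Measurable φ := Measurable.ite measurableSet_leftHalf measurable_const measurable_const
  have hvol : volume {x : unitInterval | (x : ℝ) ≤ 1 / 2} = 1 / 2 := by
    simpa using volume_leftHalf_inter_preimage univ
  have hvol' : volume {x : unitInterval | (x : ℝ) ≤ 1 / 2}ᶜ = 1 / 2 := by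
    simpa using volume_rightHalf_inter_preimage univ
  have hmp (n : ℕ) : MeasurePreserving doubling^[n] volume volume :=
    measurePreserving_doubling.iterate n
  have hindep (k : ℕ) : ProbabilityTheory.IndepFun φ (doubling^[k + 1]) volume := by
    rw [ProbabilityTheory.indepFun_iff_measure_inter_preimage_eq_mul]
    intro s t hs ht
    have hvt : volume (doubling^[k] ⁻¹' t) = volume t := (hmp k).measure_preimage
      ht.nullMeasurableSet
    have hvt' : volume (doubling^[k + 1] ⁻¹' t) = volume t := (hmp (k + 1)).measure_preimage
      ht.nullMeasurableSet
    have hpre : doubling^[k + 1] ⁻¹' t = doubling ⁻¹' (doubling^[k] ⁻¹' t) := by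
      rw [Function.iterate_succ, preimage_comp]
    -- As `φ` takes only the values `a` and `b`, the preimage of `s` is everything, one of the
    -- halves, or empty.
    by_cases ha : a ∈ s <;> by_cases hb : b ∈ s
    · have : φ ⁻¹' s = univ := by
        ext x; simp only [hφ, mem_preimage, mem_univ, iff_true]; split_ifs <;> assumption
      rw [this]; simp
    · have : φ ⁻¹' s = {x : unitInterval | (x : ℝ) ≤ 1 / 2} := by
        ext x; simp only [hφ, mem_preimage, mem_ofPred_eq]; split_ifs with h <;> simp only [ha, hb, h]
      rw [this, hvol, hvt', hpre, volume_leftHalf_inter_preimage, hvt, ENNReal.div_eq_inv_mul,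
        one_div]
    · have : φ ⁻¹' s = {x : unitInterval | (x : ℝ) ≤ 1 / 2}ᶜ := by
        ext x; simp only [hφ, mem_preimage, mem_ofPred_eq, mem_compl_iff]
        split_ifs with h <;> simp only [ha, hb, h, not_true_eq_false, not_false_eq_true]
      rw [this, hvol', hvt', hpre, volume_rightHalf_inter_preimage, hvt, ENNReal.div_eq_inv_mul,
        one_div]
    · have : φ ⁻¹' s = ∅ := by
        ext x; simp only [hφ, mem_preimage, mem_empty_iff_false, iff_false]
        split_ifs <;> assumption
      rw [this]; simp
  -- Invariance of the measure under `doubling^[i]` reduces the pair `i < j` to the pair `0 < j -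
  -- i`.
  have hlt (i j : ℕ) (hij : i < j) :
      ProbabilityTheory.IndepFun (φ ∘ doubling^[i]) (φ ∘ doubling^[j]) volume := by
    obtain ⟨k, rfl⟩ := Nat.exists_eq_add_of_lt hij
    have h1 := (hindep k).comp measurable_id hφm
    rw [ProbabilityTheory.indepFun_iff_measure_inter_preimage_eq_mul] at h1 ⊢
    intro s t hs ht
    have hsm : MeasurableSet (φ ⁻¹' s) := hφm hs
    have htm : MeasurableSet ((φ ∘ doubling^[k + 1]) ⁻¹' t) :=
      (hφm.comp (hmp _).measurable) ht
    have e2 : (φ ∘ doubling^[i + k + 1]) ⁻¹' t =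
        doubling^[i] ⁻¹' ((φ ∘ doubling^[k + 1]) ⁻¹' t) := by
      rw [add_assoc, add_comm, Function.iterate_add]; rfl
    rw [e2, preimage_comp, ← preimage_inter,
      (hmp i).measure_preimage (hsm.inter htm).nullMeasurableSet,
      (hmp i).measure_preimage hsm.nullMeasurableSet,
      (hmp i).measure_preimage htm.nullMeasurableSet]
    exact h1 s t hs ht
  have hbound (x : unitInterval) : ‖φ x‖ ≤ max ‖a‖ ‖b‖ := by
    simp only [hφ]; split_ifs <;> simp
  have hint : Integrable φ volume :=
    Integrable.of_bound hφm.aestronglyMeasurable _ (Eventually.of_forall hbound)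
  have hmean : ∫ x, φ x = (a + b) / 2 := by
    rw [← integral_add_compl measurableSet_leftHalf hint,
      setIntegral_congr_fun (f := φ) (g := fun _ => a) measurableSet_leftHalf
        (fun x hx => if_pos hx),
      setIntegral_congr_fun (f := φ) (g := fun _ => b) measurableSet_leftHalf.compl
        (fun x hx => if_neg hx), setIntegral_const, setIntegral_const, Measure.real,
      Measure.real, hvol, hvol']
    simp; ring
  have := ProbabilityTheory.strong_law_ae_real (μ := volume) (fun i => φ ∘ doubling^[i])
    (by simpa using hint) ?_ ?_
  · rw [← hmean]
    exact this
  · intro i j hij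
    rcases lt_or_gt_of_ne hij with h | h
    · exact hlt i j h
    · exact (hlt j i h).symm
  · intro i
    have h := (hmp i).aemeasurable
    refine ⟨hφm.comp_aemeasurable h, hφm.aemeasurable, ?_⟩
    have : Measure.map (φ ∘ doubling^[i]) volume = Measure.map φ volume := by
      rw [← Measure.map_map hφm (hmp i).measurable, (hmp i).map_eq]
    simpa using this

/-! ### Transport of the notions along a measure-preserving isometry -/

section Conjugation

variable {X : Type*} [MetricSpace X]

theorem mem_omegaSet_iff {F : X → X} {x y : X} :
    y ∈ omegaSet F x ↔ MapClusterPt y atTop fun n => F^[n] x :=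
  mem_omegaLimit_singleton_iff_mapClusterPt _ _ _ _

variable {F F' : X → X} {σ : X ≃ᵢ X}

theorem omegaSet_conj (h : Function.Semiconj σ F' F) (x : X) :
    omegaSet F' x = σ ⁻¹' omegaSet F (σ x) := by
  ext y
  rw [mem_preimage, mem_omegaSet_iff, mem_omegaSet_iff]
  have : (fun n => F^[n] (σ x)) = σ ∘ fun n => F'^[n] x :=
    funext fun n => ((h.iterate_right n) x).symm
  rw [this, MapClusterPt, ← σ.toHomeomorph.isInducing.mapClusterPt_iff, MapClusterPt, MapClusterPt,
    Filter.map_map]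
  rfl

theorem basin_conj (h : Function.Semiconj σ F' F) (A : Set X) :
    basin F' (σ ⁻¹' A) = σ ⁻¹' basin F A := by
  ext x
  simp only [basin, mem_ofPred_eq, mem_preimage, omegaSet_conj h]
  exact σ.surjective.preimage_subset_preimage_iff

theorem IsCompactInvariant.conj (h : Function.Semiconj σ F' F) {A : Set X}
    (hA : IsCompactInvariant F A) : IsCompactInvariant F' (σ ⁻¹' A) := by
  refine ⟨σ.toHomeomorph.isCompact_preimage.2 hA.isCompact, ?_⟩
  have hs : σ ⁻¹' A = σ.symm '' A := σ.toEquiv.image_symm_eq_preimage A |>.symm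
  have h' : Function.Semiconj σ.symm F F' := fun x => by
    rw [σ.symm_apply_eq, h, σ.apply_symm_apply]
  rw [hs, image_image]
  simp only [← h'.eq]
  rw [← image_image σ.symm F, hA.image_eq]

theorem thickening_preimage_isometry (σ : X ≃ᵢ X) (δ : ℝ) (A : Set X) :
    Metric.thickening δ (σ ⁻¹' A) = σ ⁻¹' Metric.thickening δ A := by
  ext x
  simp only [Metric.mem_thickening_iff, mem_preimage]
  constructor
  · rintro ⟨z, hz, hd⟩
    exact ⟨σ z, hz, by rwa [σ.dist_eq]⟩
  · rintro ⟨z, hz, hd⟩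
    refine ⟨σ.symm z, by simpa using hz, ?_⟩
    rwa [← σ.dist_eq, σ.apply_symm_apply]

theorem preimage_mem_nhdsSet (σ : X ≃ᵢ X) {U A : Set X} (hU : U ∈ 𝓝ˢ A) : σ ⁻¹' U ∈ 𝓝ˢ (σ ⁻¹' A) :=
  σ.continuous.tendsto_nhdsSet (mapsTo_preimage σ A) hU

variable [MeasurableSpace X] [BorelSpace X] {m : Measure X}

theorem measure_preimage_isometry (hm : MeasurePreserving σ m m) (S : Set X) :
    m (σ ⁻¹' S) = m S :=
  MeasurePreserving.measure_preimage_equiv (f := σ.toHomeomorph.toMeasurableEquiv) hm S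

theorem IsMilnorAttractor.conj (h : Function.Semiconj σ F' F) (hm : MeasurePreserving σ m m)
    {A : Set X} (hA : IsMilnorAttractor F m A) : IsMilnorAttractor F' m (σ ⁻¹' A) := by
  refine ⟨hA.toIsCompactInvariant.conj h, ?_, fun A' hc hss heq => ?_⟩
  · rw [basin_conj h, measure_preimage_isometry hm]
    exact hA.measure_basin_ne_zero
  · have hA' : A' = σ ⁻¹' (σ '' A') := (preimage_image_eq A' σ.injective).symm
    refine hA.minimal (σ '' A') (hc.image σ.continuous) ?_ ?_
    · refine ⟨image_subset_iff.2 hss.1, fun hle => hss.2 ?_⟩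
      rw [hA']
      exact preimage_mono hle
    · rw [hA', basin_conj h, basin_conj h] at heq
      rw [← measure_symmDiff_eq_zero_iff] at heq ⊢
      rwa [← measure_preimage_isometry hm, preimage_symmDiff]

theorem IsEssentialAttractor.conj (h : Function.Semiconj σ F' F) (hm : MeasurePreserving σ m m)
    {A : Set X} (hA : IsEssentialAttractor F m A) : IsEssentialAttractor F' m (σ ⁻¹' A) := by
  refine ⟨hA.toIsCompactInvariant.conj h, ?_⟩
  simp only [basin_conj h, thickening_preimage_isometry, ← preimage_inter,
    measure_preimage_isometry hm]
  exact hA.tendsto_density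

theorem HasLocallyRiddledBasin.conj (h : Function.Semiconj σ F' F)
    (hm : MeasurePreserving σ m m) {A : Set X} (hA : HasLocallyRiddledBasin F m A) :
    HasLocallyRiddledBasin F' m (σ ⁻¹' A) := by
  refine ⟨hA.isMilnorAttractor.conj h hm, ?_⟩
  obtain ⟨U, hU, hr⟩ := hA.riddled
  refine ⟨σ ⁻¹' U, preimage_mem_nhdsSet σ hU, fun x hx ε hε => ?_⟩
  have hn (n : ℕ) : σ ⁻¹' (F^[n] ⁻¹' U) = F'^[n] ⁻¹' (σ ⁻¹' U) := by
    rw [← preimage_comp, ← preimage_comp, (h.iterate_right n).comp_eq]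
  have h1 := hr (σ x) hx ε hε
  rw [← measure_preimage_isometry hm, preimage_inter, preimage_compl, preimage_iInter,
    σ.preimage_ball, σ.symm_apply_apply] at h1
  simpa only [hn] using h1

theorem IsChaoticSaddle.conj (h : Function.Semiconj σ F' F) (hm : MeasurePreserving σ m m)
    {A : Set X} (hA : IsChaoticSaddle F m A) : IsChaoticSaddle F' m (σ ⁻¹' A) := by
  refine ⟨hA.toIsCompactInvariant.conj h, ?_, ?_, ?_⟩
  · obtain ⟨x, hx, hxA⟩ := hA.isTransitiveSet
    refine ⟨σ.symm x, by simpa using hx, ?_⟩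
    rw [omegaSet_conj h, σ.apply_symm_apply, hxA]
  · obtain ⟨U, hU, hne⟩ := hA.basin_inter_nonempty
    refine ⟨σ ⁻¹' U, preimage_mem_nhdsSet σ hU, ?_⟩
    rw [basin_conj h, ← preimage_inter]
    exact hne.preimage σ.surjective
  · rw [basin_conj h, measure_preimage_isometry hm]
    exact hA.measure_basin_eq_zero

end Conjugation

/-! ### The symmetry between the two sides -/

section Reflection

/-- The reflection of the square that exchanges the two horizontal sides. -/
noncomputable def flip : Square ≃ᵢ Square where
  toFun p := (p.1, unitInterval.symm p.2)
  invFun p := (p.1, unitInterval.symm p.2)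
  left_inv p := by simp
  right_inv p := by simp
  isometry_toFun := by
    refine Isometry.of_dist_eq fun p q => ?_
    simp only [Prod.dist_eq, Subtype.dist_eq, unitInterval.coe_symm_eq, Real.dist_eq]
    congr 1
    rw [abs_sub_comm]
    ring_nf

theorem measurePreserving_flip : MeasurePreserving flip volume volume :=
  (MeasurePreserving.id volume).prod unitInterval.measurePreserving_symm

theorem flip_preimage_bottomSide : flip ⁻¹' bottomSide = topSide := by
  ext p
  show unitInterval.symm p.2 = 0 ↔ p.2 = 1
  exact unitInterval.symm_eq_zero

theorem one_sub_mem_Ioo {β : ℝ} (h : β ∈ Ioo (0 : ℝ) 1) : 1 - β ∈ Ioo (0 : ℝ) 1 :=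
  ⟨by linarith [h.2], by linarith [h.1]⟩

theorem semiconj_flip {β₁ β₂ : ℝ} (h₁ : β₁ ∈ Ioo (0 : ℝ) 1) (h₂ : β₂ ∈ Ioo (0 : ℝ) 1) :
    Function.Semiconj flip (skewProduct β₁ β₂ h₁ h₂)
      (skewProduct (1 - β₁) (1 - β₂) (one_sub_mem_Ioo h₁) (one_sub_mem_Ioo h₂)) := by
  intro p
  show (_, _) = (_, _)
  refine Prod.ext rfl (Subtype.ext ?_)
  show ((unitInterval.symm (if (p.1 : ℝ) ≤ 1 / 2 then fiberOne β₁ h₁ p.2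
    else fiberTwo β₂ h₂ p.2) : unitInterval) : ℝ) =
    ((if (p.1 : ℝ) ≤ 1 / 2 then fiberOne (1 - β₁) _ (unitInterval.symm p.2)
      else fiberTwo (1 - β₂) _ (unitInterval.symm p.2) : unitInterval) : ℝ)
  split_ifs <;> simp only [fiberOne, fiberTwo, unitInterval.coe_symm_eq] <;> ring

end Reflection

/-! ### Basin and neighbourhoods of the bottom side -/

theorem isCompact_bottomSide : IsCompact bottomSide :=
  (isClosed_singleton.preimage continuous_snd).isCompact

/-- By compactness of the square, an orbit eventually enters every open set containing its `ω`-limit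
set, in particular every strip `y < ε`. -/
theorem mem_basin_bottomSide_iff {F : Square → Square} {p : Square} :
    p ∈ basin F bottomSide ↔ Tendsto (fun n => ((F^[n] p).2 : ℝ)) atTop (𝓝 0) := by
  constructor
  · intro hp
    rw [tendsto_order]
    refine ⟨fun a ha => Eventually.of_forall fun n => ha.trans_le (F^[n] p).2.2.1,
      fun ε hε => ?_⟩
    have hV : IsOpen {q : Square | (q.2 : ℝ) < ε} :=
      isOpen_lt (continuous_subtype_val.comp continuous_snd) continuous_const
    have := eventually_mapsTo_of_isOpen_of_omegaLimit_subset atTop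
      (fun (n : ℕ) (z : Square) => F^[n] z) {p} hV fun q hq => by
        have hq0 : q.2 = 0 := hp hq
        show (q.2 : ℝ) < ε
        rwa [hq0]
    exact this.mono fun n hn => hn (mem_singleton p)
  · intro h q hq
    rw [mem_omegaSet_iff] at hq
    have h1 : MapClusterPt (q.2 : ℝ) atTop fun n => ((F^[n] p).2 : ℝ) :=
      hq.continuousAt_comp (f := fun z : Square => (z.2 : ℝ)) (by fun_prop)
    have h2 : (q.2 : ℝ) = 0 := by
      by_contra hne
      have : Disjoint (𝓝 (q.2 : ℝ)) (𝓝 0) := disjoint_nhds_nhds.2 hne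
      exact h1.ne (disjoint_iff.1 (this.mono_right h))
    exact Subtype.ext h2

theorem thickening_bottomSide (δ : ℝ) :
    Metric.thickening δ bottomSide = univ ×ˢ {y : unitInterval | (y : ℝ) < δ} := by
  ext p
  simp only [Metric.mem_thickening_iff, mem_prod, mem_univ, true_and, mem_ofPred_eq]
  have hp (z : unitInterval) : dist z 0 = (z : ℝ) := by
    rw [Subtype.dist_eq, Real.dist_eq]; simp [abs_of_nonneg z.2.1]
  constructor
  · rintro ⟨z, hz, hd⟩
    have hz : z.2 = 0 := hz
    rw [Prod.dist_eq, hz] at hd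
    rw [← hp p.2]
    exact (le_max_right _ _).trans_lt hd
  · intro h
    refine ⟨(p.1, 0), rfl, ?_⟩
    rw [Prod.dist_eq]
    simp only [dist_self, hp, max_lt_iff]
    exact ⟨p.2.2.1.trans_lt h, h⟩

/-- If the basin contains a vertical segment of positive length above almost every point of the
bottom side, then it has density one at the bottom side. -/
theorem tendsto_density_bottomSide {F : Square → Square}
    (h : ∀ᵐ x : unitInterval, ∃ δ : ℝ, 0 < δ ∧
      ∀ y : unitInterval, (y : ℝ) < δ → (x, y) ∈ basin F bottomSide) :
    Tendsto (fun δ : ℝ => (volume : Measure Square)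
      (Metric.thickening δ bottomSide ∩ basin F bottomSide) /
      (volume : Measure Square) (Metric.thickening δ bottomSide)) (𝓝[>] 0) (𝓝 1) := by
  -- Measurability of `G δ` is not needed: continuity from below along a monotone union and the
  -- product formula for rectangles hold for arbitrary sets.
  set G : ℝ → Set unitInterval := fun δ =>
    {x | ∀ y : unitInterval, (y : ℝ) < δ → (x, y) ∈ basin F bottomSide} with hG
  have hanti {δ δ' : ℝ} (hd : δ ≤ δ') : G δ' ⊆ G δ := fun x hx y hy => hx y (hy.trans_le hd)
  have hlim : Tendsto (fun n : ℕ => volume (G (1 / ((n : ℝ) + 1)))) atTop (𝓝 1) := by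
    have hU : volume (⋃ n : ℕ, G (1 / ((n : ℝ) + 1))) = 1 := by
      rw [← measure_univ (μ := (volume : Measure unitInterval))]
      refine measure_congr (eventuallyEq_univ.2 ?_)
      filter_upwards [h] with x hx
      obtain ⟨δ, hδ, hx⟩ := hx
      obtain ⟨n, hn⟩ := exists_nat_one_div_lt hδ
      exact mem_iUnion.2 ⟨n, fun y hy => hx y (hy.trans hn)⟩
    rw [← hU]
    refine tendsto_measure_iUnion_atTop fun n k hnk => hanti ?_
    exact one_div_le_one_div_of_le (by positivity) (by gcongr)
  rw [tendsto_order]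
  refine ⟨fun c hc => ?_, fun c hc => Eventually.of_forall fun δ => ?_⟩
  · obtain ⟨n, hn⟩ := (hlim.eventually (lt_mem_nhds hc)).exists
    filter_upwards [Ioo_mem_nhdsGT (show (0 : ℝ) < 1 / ((n : ℝ) + 1) by positivity)] with δ hδ
    refine (hn.trans_le (measure_mono (hanti hδ.2.le))).trans_le ?_
    rw [thickening_bottomSide]
    have hVpos : volume {y : unitInterval | (y : ℝ) < δ} ≠ 0 := by
      have hz : min δ 1 ∈ Icc (0 : ℝ) 1 := ⟨le_min hδ.1.le zero_le_one, min_le_right _ _⟩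
      have hle : volume (Iio (⟨min δ 1, hz⟩ : unitInterval)) ≤
          volume {y : unitInterval | (y : ℝ) < δ} :=
        measure_mono fun y (hy : (y : ℝ) < min δ 1) => hy.trans_le (min_le_left _ _)
      rw [unitInterval.volume_Iio] at hle
      exact ((ENNReal.ofReal_pos.2 (lt_min hδ.1 one_pos)).trans_le hle).ne'
    rw [Measure.volume_eq_prod, Measure.prod_prod, measure_univ, one_mul,
      ENNReal.le_div_iff_mul_le (Or.inl hVpos) (Or.inl (measure_ne_top _ _)),
      ← Measure.prod_prod]
    exact measure_mono fun p hp => ⟨⟨mem_univ _, hp.2⟩, hp.1 p.2 hp.2⟩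
  · exact (ENNReal.div_le_of_le_mul (by
      rw [one_mul]; exact measure_mono inter_subset_left)).trans_lt hc

theorem measure_basin_ne_zero_of_tendsto_density {F : Square → Square}
    (h : Tendsto (fun δ : ℝ => (volume : Measure Square)
      (Metric.thickening δ bottomSide ∩ basin F bottomSide) /
      (volume : Measure Square) (Metric.thickening δ bottomSide)) (𝓝[>] 0) (𝓝 1)) :
    (volume : Measure Square) (basin F bottomSide) ≠ 0 := by
  intro h0
  have h1 (δ : ℝ) : (volume : Measure Square)
      (Metric.thickening δ bottomSide ∩ basin F bottomSide) = 0 :=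
    measure_mono_null inter_subset_right h0
  simp only [h1, ENNReal.zero_div] at h
  exact zero_ne_one (tendsto_nhds_unique tendsto_const_nhds h)

/-! ### Invariance, minimality, transitivity and linear bounds on the fibers -/

section SkewProduct

variable {β₁ β₂ : ℝ} {h₁ : β₁ ∈ Ioo (0 : ℝ) 1} {h₂ : β₂ ∈ Ioo (0 : ℝ) 1}

theorem skewProduct_iterate_fst (n : ℕ) (p : Square) :
    ((skewProduct β₁ β₂ h₁ h₂)^[n] p).1 = doubling^[n] p.1 :=
  (Function.Semiconj.iterate_right (f := Prod.fst) (ga := skewProduct β₁ β₂ h₁ h₂)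
    (gb := doubling) (fun _ => rfl) n) p

theorem skewProduct_iterate_succ_snd (n : ℕ) (p : Square) :
    ((skewProduct β₁ β₂ h₁ h₂)^[n + 1] p).2 =
      if ((doubling^[n] p.1 : unitInterval) : ℝ) ≤ 1 / 2
        then fiberOne β₁ h₁ ((skewProduct β₁ β₂ h₁ h₂)^[n] p).2
        else fiberTwo β₂ h₂ ((skewProduct β₁ β₂ h₁ h₂)^[n] p).2 := by
  rw [Function.iterate_succ_apply', ← skewProduct_iterate_fst (h₁ := h₁) (h₂ := h₂) n p]
  rfl

theorem doubling_surjective : Function.Surjective doubling := by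
  intro z
  have h0 := z.2.1
  have h1 := z.2.2
  have hx : (z : ℝ) / 2 ∈ Icc (0 : ℝ) 1 := ⟨by linarith, by linarith⟩
  have hx2 : ((⟨(z : ℝ) / 2, hx⟩ : unitInterval) : ℝ) ≤ 1 / 2 := by
    show (z : ℝ) / 2 ≤ 1 / 2; linarith
  refine ⟨⟨(z : ℝ) / 2, hx⟩, Subtype.ext ?_⟩
  rw [coe_doubling_of_le hx2]
  show 2 * ((z : ℝ) / 2) = z
  ring

theorem skewProduct_zero (x : unitInterval) :
    skewProduct β₁ β₂ h₁ h₂ (x, 0) = (doubling x, 0) := by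
  refine Prod.ext rfl (Subtype.ext ?_)
  show ((if (x : ℝ) ≤ 1 / 2 then fiberOne β₁ h₁ 0 else fiberTwo β₂ h₂ 0 : unitInterval) : ℝ) = _
  split_ifs <;> simp [fiberOne, fiberTwo]

theorem isCompactInvariant_bottomSide :
    IsCompactInvariant (skewProduct β₁ β₂ h₁ h₂) bottomSide := by
  refine ⟨isCompact_bottomSide, Subset.antisymm ?_ ?_⟩
  · rintro _ ⟨⟨x, y⟩, hp, rfl⟩
    obtain rfl : y = 0 := hp
    rw [skewProduct_zero]
    rfl
  · rintro ⟨x, y⟩ hp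
    obtain rfl : y = 0 := hp
    obtain ⟨z, rfl⟩ := doubling_surjective x
    exact ⟨(z, 0), rfl, skewProduct_zero z⟩

/-- The first coordinate returns near any `z` infinitely often, while the second is eventually
small; the two occur simultaneously. -/
theorem bottomSide_subset_omegaSet {p : Square}
    (hx : ∀ z : unitInterval, MapClusterPt z atTop fun n => doubling^[n] p.1)
    (hp : p ∈ basin (skewProduct β₁ β₂ h₁ h₂) bottomSide) :
    bottomSide ⊆ omegaSet (skewProduct β₁ β₂ h₁ h₂) p := by
  rintro ⟨z, w⟩ hw
  obtain rfl : w = 0 := hw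
  rw [mem_omegaSet_iff, mapClusterPt_iff_frequently]
  intro s hs
  rw [nhds_prod_eq, mem_prod_iff] at hs
  obtain ⟨s₁, hs₁, s₂, hs₂, hs⟩ := hs
  rw [mem_basin_bottomSide_iff] at hp
  have hp' : Tendsto (fun n => ((skewProduct β₁ β₂ h₁ h₂)^[n] p).2) atTop (𝓝 0) :=
    tendsto_subtype_rng.2 hp
  refine ((mapClusterPt_iff_frequently.1 (hx z) s₁ hs₁).and_eventually
    (hp'.eventually hs₂)).mono fun n hn => hs ⟨?_, hn.2⟩
  rw [skewProduct_iterate_fst]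
  exact hn.1

theorem isMilnorAttractor_bottomSide
    (h : (volume : Measure Square) (basin (skewProduct β₁ β₂ h₁ h₂) bottomSide) ≠ 0) :
    IsMilnorAttractor (skewProduct β₁ β₂ h₁ h₂) volume bottomSide := by
  refine ⟨isCompactInvariant_bottomSide, h, fun A' _ hss heq => h ?_⟩
  have hae : ∀ᵐ p : Square, ∀ z : unitInterval,
      MapClusterPt z atTop fun n => doubling^[n] p.1 :=
    Measure.quasiMeasurePreserving_fst.ae ae_forall_mapClusterPt_doubling
  rw [measure_eq_zero_iff_ae_notMem]
  filter_upwards [hae, heq.mem_iff] with p hp hiff hpb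
  have h1 : omegaSet (skewProduct β₁ β₂ h₁ h₂) p ⊆ A' := hiff.2 hpb
  exact hss.2 ((bottomSide_subset_omegaSet hp hpb).trans h1)

theorem isTransitiveSet_bottomSide :
    IsTransitiveSet (skewProduct β₁ β₂ h₁ h₂) bottomSide := by
  obtain ⟨x, hx⟩ := ae_forall_mapClusterPt_doubling.exists
  have hb : ((x, 0) : Square) ∈ basin (skewProduct β₁ β₂ h₁ h₂) bottomSide := by
    rw [mem_basin_bottomSide_iff]
    have (n : ℕ) : (skewProduct β₁ β₂ h₁ h₂)^[n] (x, 0) ∈ bottomSide := by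
      induction n with
      | zero => rfl
      | succ n ih =>
        rw [Function.iterate_succ_apply', ← (isCompactInvariant_bottomSide (h₁ := h₁)
          (h₂ := h₂)).image_eq]
        exact mem_image_of_mem _ ih
    have h0 (n : ℕ) : (((skewProduct β₁ β₂ h₁ h₂)^[n] (x, 0)).2 : ℝ) = 0 := by
      rw [show ((skewProduct β₁ β₂ h₁ h₂)^[n] (x, 0)).2 = 0 from this n]; rfl
    simp only [h0]
    exact tendsto_const_nhds
  exact ⟨(x, 0), rfl, Subset.antisymm hb (bottomSide_subset_omegaSet hx hb)⟩

/-- This bound and the next three compare the fiber maps with their derivatives `1 - β₁` and `1 +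
β₂` at `0`; the error `2 * y` appears only on the side where the linear bound fails. -/
theorem fiberOne_le (y : unitInterval) :
    (fiberOne β₁ h₁ y : ℝ) ≤ (1 - β₁ + 2 * y) * y := by
  obtain ⟨y, h0, h1⟩ := y
  show y + y * (1 - y) * (y - β₁) ≤ (1 - β₁ + 2 * y) * y
  nlinarith [mul_nonneg (mul_nonneg h0 h0) h0, mul_nonneg (mul_nonneg h0 h0) (sub_nonneg.2 h₁.2.le)]

theorem le_fiberOne (y : unitInterval) : (1 - β₁) * (y : ℝ) ≤ fiberOne β₁ h₁ y := by
  obtain ⟨y, h0, h1⟩ := y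
  show (1 - β₁) * y ≤ y + y * (1 - y) * (y - β₁)
  nlinarith [mul_nonneg (mul_nonneg h0 h0) h₁.1.le, mul_nonneg (mul_nonneg h0 h0) (sub_nonneg.2 h1)]

theorem fiberTwo_le (y : unitInterval) : (fiberTwo β₂ h₂ y : ℝ) ≤ (1 + β₂) * y := by
  obtain ⟨y, h0, h1⟩ := y
  show y - y * (1 - y) * (y - β₂) ≤ (1 + β₂) * y
  nlinarith [mul_nonneg (mul_nonneg h0 h0) h₂.1.le, mul_nonneg (mul_nonneg h0 h0) (sub_nonneg.2 h1)]

theorem le_fiberTwo (y : unitInterval) :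
    (1 + β₂ - 2 * y) * (y : ℝ) ≤ fiberTwo β₂ h₂ y := by
  obtain ⟨y, h0, h1⟩ := y
  show (1 + β₂ - 2 * y) * y ≤ y - y * (1 - y) * (y - β₂)
  nlinarith [mul_nonneg (mul_nonneg h0 h0) h0, mul_nonneg (mul_nonneg h0 h0) (sub_nonneg.2 h₂.2.le)]

/-- Unlike `le_fiberTwo`, this keeps a positive factor at every height, so orbits never reach the
side in finite time. -/
theorem mul_le_fiberTwo (y : unitInterval) : β₂ * (y : ℝ) ≤ fiberTwo β₂ h₂ y := by
  obtain ⟨y, h0, h1⟩ := y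
  show β₂ * y ≤ y - y * (1 - y) * (y - β₂)
  have hβ := h₂.2
  have : y - y * (1 - y) * (y - β₂) - β₂ * y = y * (1 - y * (1 - y) - β₂ * y) := by ring
  have h3 : 0 ≤ 1 - y * (1 - y) - β₂ * y := by 
    nlinarith [mul_nonneg h0 (sub_nonneg.2 hβ.le), sq_nonneg (1 - y)]
  nlinarith [mul_nonneg h0 h3]

theorem skewProduct_iterate_snd_pos {p : Square} (hp : 0 < (p.2 : ℝ)) (n : ℕ) :
    0 < (((skewProduct β₁ β₂ h₁ h₂)^[n] p).2 : ℝ) := by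
  induction n with
  | zero => exact hp
  | succ n ih =>
    rw [skewProduct_iterate_succ_snd]
    split_ifs
    · exact (mul_pos (by linarith [h₁.2]) ih).trans_le (le_fiberOne _)
    · exact (mul_pos h₂.1 ih).trans_le (mul_le_fiberTwo _)

end SkewProduct

/-! ### The sign of the transverse Lyapunov exponent -/

/-- The logarithm of the product of the multipliers `exp a` and `exp b` collected in the left and
the right half of the interval along the first `n` points of an orbit of the doubling map. -/
noncomputable def logMultiplier (a b : ℝ) (x : unitInterval) (n : ℕ) : ℝ :=
  ∑ i ∈ Finset.range n, if ((doubling^[i] x : unitInterval) : ℝ) ≤ 1 / 2 then a else b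

theorem logMultiplier_succ (a b : ℝ) (x : unitInterval) (n : ℕ) :
    logMultiplier a b x (n + 1) = logMultiplier a b x n +
      if ((doubling^[n] x : unitInterval) : ℝ) ≤ 1 / 2 then a else b :=
  Finset.sum_range_succ _ _

theorem ae_tendsto_logMultiplier_div (a b : ℝ) :
    ∀ᵐ x : unitInterval, Tendsto (fun n : ℕ => logMultiplier a b x n / n) atTop
      (𝓝 ((a + b) / 2)) :=
  ae_tendsto_average_doubling a b

theorem ae_tendsto_logMultiplier_atBot {a b : ℝ} (h : a + b < 0) :
    ∀ᵐ x : unitInterval, Tendsto (logMultiplier a b x) atTop atBot := by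
  filter_upwards [ae_tendsto_logMultiplier_div a b] with x hx
  refine (hx.neg_mul_atTop (by linarith) tendsto_natCast_atTop_atTop).congr' ?_
  filter_upwards [eventually_ne_atTop 0] with n hn
  field_simp

theorem ae_tendsto_logMultiplier_atTop {a b : ℝ} (h : 0 < a + b) :
    ∀ᵐ x : unitInterval, Tendsto (logMultiplier a b x) atTop atTop := by
  filter_upwards [ae_tendsto_logMultiplier_div a b] with x hx
  refine (hx.pos_mul_atTop (by linarith) tendsto_natCast_atTop_atTop).congr' ?_
  filter_upwards [eventually_ne_atTop 0] with n hn
  field_simp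

section SkewProduct

variable {β₁ β₂ : ℝ} {h₁ : β₁ ∈ Ioo (0 : ℝ) 1} {h₂ : β₂ ∈ Ioo (0 : ℝ) 1}

/-- If the transverse Lyapunov exponent of the bottom side is negative, then the basin contains a
vertical segment above almost every point of the bottom side. -/
theorem ae_exists_segment_subset_basin (h : (1 - β₁) * (1 + β₂) < 1) :
    ∀ᵐ x : unitInterval, ∃ δ : ℝ, 0 < δ ∧ ∀ y : unitInterval, (y : ℝ) < δ →
      (x, y) ∈ basin (skewProduct β₁ β₂ h₁ h₂) bottomSide := by
  have hb10 := h₁.1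
  have hb11 := h₁.2
  have hb20 := h₂.1
  have hb21 := h₂.2
  -- As `1 + β₂ < 2`, enlarging the first factor by `2 * η` uses up less than half of the gap below
  -- `1`.
  set η : ℝ := (1 - (1 - β₁) * (1 + β₂)) / 8 with hη
  have hη0 : 0 < η := by rw [hη]; linarith
  have ha : 0 < 1 - β₁ + 2 * η := by linarith
  have hb : 0 < 1 + β₂ := by linarith
  have hab : (1 - β₁ + 2 * η) * (1 + β₂) < 1 := by nlinarith
  have hlog : Real.log (1 - β₁ + 2 * η) + Real.log (1 + β₂) < 0 := by
    rw [← Real.log_mul ha.ne' hb.ne']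
    exact Real.log_neg (mul_pos ha hb) hab
  filter_upwards [ae_tendsto_logMultiplier_atBot hlog] with x hx
  set S := logMultiplier (Real.log (1 - β₁ + 2 * η)) (Real.log (1 + β₂)) x with hS
  have hexp : Tendsto (fun n => Real.exp (S n)) atTop (𝓝 0) := Real.tendsto_exp_atBot.comp hx
  obtain ⟨M, hM⟩ := hexp.bddAbove_range
  have hM (n : ℕ) : Real.exp (S n) ≤ M := hM (mem_range_self n)
  have hMpos : 0 < M := (Real.exp_pos _).trans_le (hM 0)
  -- Starting below `η / M` keeps `exp (S n) * y` below `η` for all `n`, so the induction never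
  -- leaves the strip where the factor `1 - β₁ + 2 * η` is valid.
  refine ⟨η / M, by positivity, fun y hy => ?_⟩
  have hyM : M * y < η := by rwa [lt_div_iff₀' hMpos] at hy
  have hy0 := y.2.1
  have hbound (n : ℕ) : (((skewProduct β₁ β₂ h₁ h₂)^[n] (x, y)).2 : ℝ) ≤
      Real.exp (S n) * y := by
    induction n with
    | zero => simp [hS, logMultiplier]
    | succ n ih =>
      rw [skewProduct_iterate_succ_snd, hS, logMultiplier_succ, ← hS, Real.exp_add]
      set z := ((skewProduct β₁ β₂ h₁ h₂)^[n] (x, y)).2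
      have hz0 := z.2.1
      have hz : (z : ℝ) ≤ η := by
        have := mul_le_mul_of_nonneg_right (hM n) hy0
        linarith
      split_ifs
      · rw [Real.exp_log ha]
        calc _ ≤ (1 - β₁ + 2 * (z : ℝ)) * z := fiberOne_le z
          _ ≤ (1 - β₁ + 2 * η) * z := by gcongr
          _ ≤ (1 - β₁ + 2 * η) * (Real.exp (S n) * y) := by gcongr
          _ = _ := by ring
      · rw [Real.exp_log hb]
        calc _ ≤ (1 + β₂) * (z : ℝ) := fiberTwo_le z
          _ ≤ (1 + β₂) * (Real.exp (S n) * y) := by gcongr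
          _ = _ := by ring
  rw [mem_basin_bottomSide_iff]
  have hlim : Tendsto (fun n => Real.exp (S n) * y) atTop (𝓝 0) := by
    simpa using hexp.mul_const (y : ℝ)
  exact squeeze_zero (fun n => (((skewProduct β₁ β₂ _ _)^[n] (x, y)).2).2.1) hbound hlim

/-- If the transverse Lyapunov exponent of the bottom side is positive, then above almost every
point of the bottom side no other point is in the basin. -/
theorem ae_forall_notMem_basin (h : 1 < (1 - β₁) * (1 + β₂)) :
    ∀ᵐ x : unitInterval, ∀ y : unitInterval, y ≠ 0 →
      (x, y) ∉ basin (skewProduct β₁ β₂ h₁ h₂) bottomSide := by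
  have hb10 := h₁.1
  have hb11 := h₁.2
  have hb20 := h₂.1
  have hb21 := h₂.2
  -- As `1 - β₁ < 1`, lowering the second factor by `2 * η` costs less than half of the excess over
  -- `1`.
  set η : ℝ := ((1 - β₁) * (1 + β₂) - 1) / 4 with hη
  have hη0 : 0 < η := by rw [hη]; linarith
  have ha : 0 < 1 - β₁ := by linarith
  have hab : 1 < (1 - β₁) * (1 + β₂ - 2 * η) := by nlinarith
  have hb : 0 < 1 + β₂ - 2 * η := pos_of_mul_pos_right (by linarith) ha.le
  have hlog : 0 < Real.log (1 - β₁) + Real.log (1 + β₂ - 2 * η) := by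
    rw [← Real.log_mul ha.ne' hb.ne']
    exact Real.log_pos hab
  filter_upwards [ae_tendsto_logMultiplier_atTop hlog] with x hx y hy hbas
  set S := logMultiplier (Real.log (1 - β₁)) (Real.log (1 + β₂ - 2 * η)) x with hS
  rw [mem_basin_bottomSide_iff] at hbas
  set u : ℕ → unitInterval :=
    fun n => ((skewProduct β₁ β₂ h₁ h₂)^[n] (x, y)).2 with hu
  -- A basin orbit stays below `η` from time `N` on; the lower bounds then multiply up and force it
  -- above `1`.
  obtain ⟨N, hN⟩ := eventually_atTop.1 (hbas.eventually (gt_mem_nhds hη0))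
  have hpos : 0 < (u N : ℝ) :=
    skewProduct_iterate_snd_pos (p := (x, y)) (unitInterval.pos_iff_ne_zero.2 hy) N
  have hgrow (n : ℕ) (hn : N ≤ n) : Real.exp (S n) * (Real.exp (-S N) * u N) ≤ u n := by
    induction n, hn using Nat.le_induction with
    | base => rw [← mul_assoc, ← Real.exp_add]; simp
    | succ n hn ih =>
      have hstep : u (n + 1) = if ((doubling^[n] x : unitInterval) : ℝ) ≤ 1 / 2
        then fiberOne β₁ h₁ (u n) else fiberTwo β₂ h₂ (u n) :=
        skewProduct_iterate_succ_snd n (x, y)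
      have hz0 := (u n).2.1
      have hz : (u n : ℝ) < η := hN n hn
      rw [hstep, hS, logMultiplier_succ, ← hS, Real.exp_add]
      split_ifs
      · rw [Real.exp_log ha]
        calc _ = (1 - β₁) * (Real.exp (S n) * (Real.exp (-S N) * u N)) := by ring
          _ ≤ (1 - β₁) * (u n : ℝ) := by gcongr
          _ ≤ _ := le_fiberOne (u n)
      · rw [Real.exp_log hb]
        calc _ = (1 + β₂ - 2 * η) * (Real.exp (S n) * (Real.exp (-S N) * u N)) := by ring
          _ ≤ (1 + β₂ - 2 * η) * (u n : ℝ) := by gcongr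
          _ ≤ (1 + β₂ - 2 * (u n : ℝ)) * (u n : ℝ) := by gcongr
          _ ≤ _ := le_fiberTwo (u n)
  have hlim : Tendsto (fun n => Real.exp (S n) * (Real.exp (-S N) * u N)) atTop atTop :=
    (Real.tendsto_exp_atTop.comp hx).atTop_mul_const (mul_pos (Real.exp_pos _) hpos)
  obtain ⟨n, hn, hn1⟩ := ((eventually_ge_atTop N).and (hlim.eventually_gt_atTop 1)).exists
  exact absurd ((hgrow n hn).trans (u n).2.2) (not_le.2 hn1)

/-! ### Escape from the bottom side near each of its points -/

/-- Reading off the `N` digits of `m` makes the iterate affine on a dyadic interval. Requiring `0 <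
t` excludes left endpoints, where the value `1` at `1 / 2` would break the formula. -/
theorem iterate_doubling_dyadic (N m : ℕ) (hm : m < 2 ^ N) (t : unitInterval) (ht : 0 < (t : ℝ))
    (x : unitInterval) (hx : 2 ^ N * (x : ℝ) = m + t) : doubling^[N] x = t := by
  induction N generalizing m x with
  | zero =>
    obtain rfl : m = 0 := by simpa using hm
    exact Subtype.ext (by simpa using hx)
  | succ N ih =>
    rw [Function.iterate_succ_apply]
    have hN : (0 : ℝ) < 2 ^ N := by positivity
    have ht1 := t.2.2
    rw [pow_succ] at hx hm
    rcases lt_or_ge m (2 ^ N) with h | h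
    · have h' : (m : ℝ) + 1 ≤ 2 ^ N := by exact_mod_cast h
      have hle : (x : ℝ) ≤ 1 / 2 := by
        by_contra! hlt
        nlinarith [mul_lt_mul_of_pos_left hlt hN]
      refine ih m h _ ?_
      rw [coe_doubling_of_le hle, ← hx]; ring
    · obtain ⟨k, rfl⟩ := Nat.exists_eq_add_of_le h
      push_cast at hx
      have hk : (0 : ℝ) ≤ k := by positivity
      have hlt : 1 / 2 < (x : ℝ) := by
        by_contra! hle
        nlinarith [mul_le_mul_of_nonneg_left hle hN.le]
      refine ih k (by omega) _ ?_
      rw [coe_doubling_of_lt hlt]; linarith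

theorem iterate_doubling_near_one (K : ℕ) (t : unitInterval) (ht : 1 - (t : ℝ) < (1 / 2) ^ K)
    (j : ℕ) (hj : j < K) : 1 / 2 < ((doubling^[j] t : unitInterval) : ℝ) := by
  induction K generalizing t j with
  | zero => omega
  | succ K ih =>
    have hhalf : 1 / 2 < (t : ℝ) := by
      have : ((1 : ℝ) / 2) ^ (K + 1) ≤ 1 / 2 :=
        pow_le_of_le_one (by norm_num) (by norm_num) (by omega)
      linarith
    cases j with
    | zero => exact hhalf
    | succ j =>
      rw [Function.iterate_succ_apply]
      refine ih _ ?_ j (by omega)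
      rw [coe_doubling_of_lt hhalf]
      rw [pow_succ] at ht
      linarith

/-- The factor `(1 - β₁) * β₂` is below the contraction bound of either fiber map, so the estimate
does not depend on the digits. -/
theorem pow_mul_le_skewProduct_iterate_snd (p : Square) (n : ℕ) :
    (1 - β₁) ^ n * β₂ ^ n * (p.2 : ℝ) ≤ ((skewProduct β₁ β₂ h₁ h₂)^[n] p).2 := by
  have ha : 0 < 1 - β₁ := by linarith [h₁.2]
  have hb := h₂.1
  induction n with
  | zero => simp
  | succ n ih =>
    rw [skewProduct_iterate_succ_snd]
    set z := ((skewProduct β₁ β₂ h₁ h₂)^[n] p).2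
    have hz0 := z.2.1
    have key : (1 - β₁) ^ (n + 1) * β₂ ^ (n + 1) * (p.2 : ℝ) ≤ (1 - β₁) * β₂ * z := by
      calc _ = (1 - β₁) * β₂ * ((1 - β₁) ^ n * β₂ ^ n * (p.2 : ℝ)) := by ring
        _ ≤ _ := by gcongr
    refine key.trans ?_
    split_ifs
    · refine le_trans ?_ (le_fiberOne z)
      exact mul_le_mul_of_nonneg_right (mul_le_of_le_one_right ha.le h₂.2.le) hz0
    · refine le_trans ?_ (mul_le_fiberTwo z)
      exact mul_le_mul_of_nonneg_right
        (mul_le_of_le_one_left hb.le (by linarith [h₁.1])) hz0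

/-- An orbit whose first coordinate makes a long enough passage through the right half of the
interval leaves the strip `y < β₂ / 4`. -/
theorem exists_le_skewProduct_iterate_snd {p : Square} {N K : ℕ}
    (hdig : ∀ j < K, 1 / 2 < ((doubling^[N + j] p.1 : unitInterval) : ℝ))
    (hK : 1 < (1 + β₂ / 2) ^ K * ((1 - β₁) ^ N * β₂ ^ N * (p.2 : ℝ))) :
    ∃ n, β₂ / 4 ≤ (((skewProduct β₁ β₂ h₁ h₂)^[n] p).2 : ℝ) := by
  -- Below height `β₂ / 4` the factor `1 + β₂ - 2 * y` is at least `1 + β₂ / 2`; `K` such steps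
  -- would lift the orbit above `1`.
  by_contra! hlt
  have hb := h₂.1
  have hgrow (j : ℕ) (hj : j ≤ K) :
      (1 + β₂ / 2) ^ j * ((1 - β₁) ^ N * β₂ ^ N * (p.2 : ℝ)) ≤
        ((skewProduct β₁ β₂ h₁ h₂)^[N + j] p).2 := by
    induction j with
    | zero => simpa using pow_mul_le_skewProduct_iterate_snd p N
    | succ j ih =>
      have ih := ih (by omega)
      have hz := hlt (N + j)
      rw [← add_assoc, skewProduct_iterate_succ_snd, if_neg (not_le.2 (hdig j (by omega)))]
      set z := ((skewProduct β₁ β₂ h₁ h₂)^[N + j] p).2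
      have hz0 := z.2.1
      calc _ = (1 + β₂ / 2) * ((1 + β₂ / 2) ^ j * ((1 - β₁) ^ N * β₂ ^ N * (p.2 : ℝ))) := by ring
        _ ≤ (1 + β₂ / 2) * (z : ℝ) := by gcongr
        _ ≤ (1 + β₂ - 2 * (z : ℝ)) * (z : ℝ) :=
          mul_le_mul_of_nonneg_right (by linarith) hz0
        _ ≤ _ := le_fiberTwo z
  have := (hgrow K le_rfl).trans (((skewProduct β₁ β₂ h₁ h₂)^[N + K] p).2).2.2
  linarith

/-- Every ball centred at the bottom side contains a set of positive measure of points that leave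
the strip `y < β₂ / 4`. -/
theorem measure_ball_inter_escape_pos (x : unitInterval) {ε : ℝ} (hε : 0 < ε) :
    0 < (volume : Measure Square) (Metric.ball (x, 0) ε ∩
      (⋂ n : ℕ, (skewProduct β₁ β₂ h₁ h₂)^[n] ⁻¹' {p | (p.2 : ℝ) < β₂ / 4})ᶜ) := by
  -- Dyadic intervals of level `N` are shorter than `ε`, so the one around `x` fits in the ball; for
  -- `x = 1` the last one is taken.
  obtain ⟨N, hN⟩ := exists_pow_lt_of_lt_one hε (show (1 / 2 : ℝ) < 1 by norm_num)
  have hpN : (0 : ℝ) < 2 ^ N := by positivity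
  have hx0 := x.2.1
  have hx1 := x.2.2
  obtain ⟨m, hm, hmx, hxm⟩ : ∃ m : ℕ, m < 2 ^ N ∧ (m : ℝ) ≤ 2 ^ N * x ∧
      2 ^ N * (x : ℝ) ≤ m + 1 := by
    rcases eq_or_lt_of_le hx1 with h | h
    · have hle : 1 ≤ 2 ^ N := Nat.one_le_two_pow
      refine ⟨2 ^ N - 1, by omega, ?_, ?_⟩ <;> rw [h] <;> push_cast [Nat.cast_sub hle] <;> linarith
    · refine ⟨⌊2 ^ N * (x : ℝ)⌋₊, ?_, Nat.floor_le (by positivity), (Nat.lt_floor_add_one _).le⟩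
      rw [Nat.floor_lt (by positivity)]
      push_cast
      nlinarith
  set y₀ : ℝ := min ε 1 / 2 with hy₀
  have hmin : 0 < min ε 1 := lt_min hε one_pos
  have hy₀0 : 0 < y₀ := by positivity
  have hminε : min ε 1 ≤ ε := min_le_left _ _
  have hmin1 : min ε 1 ≤ 1 := min_le_right _ _
  have hc : 0 < (1 - β₁) ^ N * β₂ ^ N * y₀ := by
    have := h₁.2
    have := h₂.1
    have : 0 < 1 - β₁ := by linarith
    positivity
  -- The run of `K` right-half visits must outweigh the worst possible contraction in the first `N`
  -- steps, starting from height `y₀`.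
  obtain ⟨K, hK⟩ := pow_unbounded_of_one_lt (1 / ((1 - β₁) ^ N * β₂ ^ N * y₀))
    (show 1 < 1 + β₂ / 2 by linarith [h₂.1])
  rw [div_lt_iff₀ hc] at hK
  have hm1 : (m : ℝ) + 1 ≤ 2 ^ N := by exact_mod_cast hm
  have hκ0 : (0 : ℝ) < (1 / 2) ^ K := by positivity
  have hκ1 : ((1 : ℝ) / 2) ^ K ≤ 1 := pow_le_one₀ (by norm_num) (by norm_num)
  have hm0 : (0 : ℝ) ≤ m := by positivity
  have ha : ((m : ℝ) + 1 - (1 / 2) ^ K) / 2 ^ N ∈ Icc (0 : ℝ) 1 :=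
    ⟨div_nonneg (by linarith) hpN.le, by rw [div_le_one hpN]; linarith⟩
  have hb : ((m : ℝ) + 1) / 2 ^ N ∈ Icc (0 : ℝ) 1 :=
    ⟨by positivity, by rw [div_le_one hpN]; linarith⟩
  have hc' : y₀ ∈ Icc (0 : ℝ) 1 := ⟨hy₀0.le, by linarith⟩
  have hd : min ε 1 ∈ Icc (0 : ℝ) 1 := ⟨hmin.le, hmin1⟩
  -- The base of the rectangle is the final fraction `(1 / 2) ^ K` of the dyadic interval: there the
  -- `N`-th iterate lies within `(1 / 2) ^ K` of `1`.
  have hsub : Ioo (⟨_, ha⟩ : unitInterval) ⟨_, hb⟩ ×ˢ Ioo (⟨_, hc'⟩ : unitInterval) ⟨_, hd⟩ ⊆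
      Metric.ball (x, 0) ε ∩
      (⋂ n : ℕ, (skewProduct β₁ β₂ h₁ h₂)^[n] ⁻¹' {p | (p.2 : ℝ) < β₂ / 4})ᶜ := by
    rintro ⟨z, y⟩ ⟨⟨hz1, hz2⟩, hy1, hy2⟩
    have hz1 : ((m : ℝ) + 1 - (1 / 2) ^ K) / 2 ^ N < (z : ℝ) := hz1
    have hz2 : (z : ℝ) < ((m : ℝ) + 1) / 2 ^ N := hz2
    have hy1 : y₀ < (y : ℝ) := hy1
    have hy2 : (y : ℝ) < min ε 1 := hy2
    rw [div_lt_iff₀' hpN] at hz1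
    rw [lt_div_iff₀' hpN] at hz2
    constructor
    · rw [Metric.mem_ball, Prod.dist_eq, max_lt_iff]
      constructor
      · rw [Subtype.dist_eq, Real.dist_eq]
        refine lt_of_le_of_lt ?_ hN
        rw [one_div, inv_pow, ← one_div, le_div_iff₀' hpN, ← abs_of_pos hpN, ← abs_mul, abs_le]
        show -1 ≤ 2 ^ N * ((z : ℝ) - x) ∧ 2 ^ N * ((z : ℝ) - x) ≤ 1
        constructor <;> linarith
      · rw [Subtype.dist_eq, Real.dist_eq]
        show |(y : ℝ) - 0| < ε
        rw [sub_zero, abs_of_nonneg y.2.1]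
        linarith
    · have ht : 2 ^ N * (z : ℝ) - m ∈ Icc (0 : ℝ) 1 := ⟨by linarith, by linarith⟩
      have hit : doubling^[N] z = ⟨_, ht⟩ :=
        iterate_doubling_dyadic N m hm ⟨_, ht⟩ (by show 0 < 2 ^ N * (z : ℝ) - m; linarith) z
          (by show 2 ^ N * (z : ℝ) = m + (2 ^ N * (z : ℝ) - m); ring)
      obtain ⟨n, hn⟩ := exists_le_skewProduct_iterate_snd (h₁ := h₁) (h₂ := h₂) (p := (z, y))
        (N := N) (K := K)
        (fun j hj => by
          rw [add_comm, Function.iterate_add_apply]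
          show 1 / 2 < ((doubling^[j] (doubling^[N] z) : unitInterval) : ℝ)
          rw [hit]
          exact iterate_doubling_near_one K _
            (by show 1 - (2 ^ N * (z : ℝ) - m) < (1 / 2) ^ K; linarith) j hj)
        (hK.trans_le (by
          have h1 := h₁.2
          have h2 := h₂.1
          have : 0 < 1 - β₁ := by linarith
          gcongr))
      intro hmem
      exact absurd (mem_iInter.1 hmem n) (not_lt.2 hn)
  refine lt_of_lt_of_le ?_ (measure_mono hsub)
  rw [Measure.volume_eq_prod, Measure.prod_prod, unitInterval.volume_Ioo, unitInterval.volume_Ioo]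
  refine ENNReal.mul_pos ?_ ?_
  · refine (ENNReal.ofReal_pos.2 ?_).ne'
    show 0 < ((m : ℝ) + 1) / 2 ^ N - ((m : ℝ) + 1 - (1 / 2) ^ K) / 2 ^ N
    rw [← sub_div]
    exact div_pos (by linarith) hpN
  · refine (ENNReal.ofReal_pos.2 ?_).ne'
    show 0 < min ε 1 - y₀
    linarith

/-! ### Conclusions for the bottom side and the theorem -/

theorem isEssentialAttractor_bottomSide (h : (1 - β₁) * (1 + β₂) < 1) :
    IsEssentialAttractor (skewProduct β₁ β₂ h₁ h₂) volume bottomSide :=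
  ⟨isCompactInvariant_bottomSide,
    tendsto_density_bottomSide (ae_exists_segment_subset_basin h)⟩

theorem hasLocallyRiddledBasin_bottomSide (h : (1 - β₁) * (1 + β₂) < 1) :
    HasLocallyRiddledBasin (skewProduct β₁ β₂ h₁ h₂) volume bottomSide := by
  refine ⟨isMilnorAttractor_bottomSide (measure_basin_ne_zero_of_tendsto_density
    (isEssentialAttractor_bottomSide h).tendsto_density), {p | (p.2 : ℝ) < β₂ / 4}, ?_, ?_⟩
  · refine IsOpen.mem_nhdsSet (isOpen_lt (by fun_prop) continuous_const) |>.2 fun p hp => ?_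
    have hp : p.2 = 0 := hp
    show (p.2 : ℝ) < β₂ / 4
    rw [hp]
    show (0 : ℝ) < β₂ / 4
    linarith [h₂.1]
  · rintro ⟨x, y⟩ hp ε hε
    obtain rfl : y = 0 := hp
    exact measure_ball_inter_escape_pos x hε

theorem isChaoticSaddle_bottomSide (h : 1 < (1 - β₁) * (1 + β₂)) :
    IsChaoticSaddle (skewProduct β₁ β₂ h₁ h₂) volume bottomSide := by
  refine ⟨isCompactInvariant_bottomSide, isTransitiveSet_bottomSide, ?_, ?_⟩
  -- A point of the side whose `ω`-limit set is the side lies in the basin, so the whole square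
  -- serves as neighbourhood.
  · obtain ⟨p, hp, hpω⟩ := isTransitiveSet_bottomSide (h₁ := h₁) (h₂ := h₂)
    exact ⟨univ, univ_mem, p, hpω.subset, mem_univ p⟩
  · rw [measure_eq_zero_iff_ae_notMem]
    have h1 : ∀ᵐ p : Square, ∀ y : unitInterval, y ≠ 0 →
        (p.1, y) ∉ basin (skewProduct β₁ β₂ h₁ h₂) bottomSide :=
      Measure.quasiMeasurePreserving_fst.ae (ae_forall_notMem_basin h)
    have h2 : ∀ᵐ p : Square, p.2 ≠ 0 :=
      Measure.quasiMeasurePreserving_snd.ae (Measure.ae_ne volume 0)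
    filter_upwards [h1, h2] with p hp1 hp2
    exact hp1 p.2 hp2

end SkewProduct

end RiddledBasin

theorem theorem3p3 (β₁ β₂ : ℝ) (h₁ : β₁ ∈ Set.Ioo (0 : ℝ) 1) (h₂ : β₂ ∈ Set.Ioo (0 : ℝ) 1) :
    ((1 / 2 < β₁ ∨ (β₁ ≤ 1 / 2 ∧ β₂ < 1 / (1 - β₁) - 1)) →
      RiddledBasin.IsMilnorAttractor
        (RiddledBasin.skewProduct β₁ β₂ h₁ h₂) MeasureTheory.volume RiddledBasin.bottomSide ∧
      RiddledBasin.IsEssentialAttractor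
        (RiddledBasin.skewProduct β₁ β₂ h₁ h₂) MeasureTheory.volume RiddledBasin.bottomSide ∧
      RiddledBasin.HasLocallyRiddledBasin
        (RiddledBasin.skewProduct β₁ β₂ h₁ h₂) MeasureTheory.volume RiddledBasin.bottomSide) ∧
    ((β₁ < 1 / 2 ∨ (1 / 2 ≤ β₁ ∧ 2 - 1 / β₁ < β₂)) →
      RiddledBasin.IsMilnorAttractor
        (RiddledBasin.skewProduct β₁ β₂ h₁ h₂) MeasureTheory.volume RiddledBasin.topSide ∧
      RiddledBasin.IsEssentialAttractor
        (RiddledBasin.skewProduct β₁ β₂ h₁ h₂) MeasureTheory.volume RiddledBasin.topSide ∧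
      RiddledBasin.HasLocallyRiddledBasin
        (RiddledBasin.skewProduct β₁ β₂ h₁ h₂) MeasureTheory.volume RiddledBasin.topSide) ∧
    (β₁ < 1 / 2 → 1 / (1 - β₁) - 1 < β₂ →
      RiddledBasin.IsChaoticSaddle
        (RiddledBasin.skewProduct β₁ β₂ h₁ h₂) MeasureTheory.volume RiddledBasin.bottomSide) ∧
    (1 / 2 < β₁ → β₂ < 2 - 1 / β₁ →
      RiddledBasin.IsChaoticSaddle
        (RiddledBasin.skewProduct β₁ β₂ h₁ h₂) MeasureTheory.volume RiddledBasin.topSide) := by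
  have hs := RiddledBasin.semiconj_flip h₁ h₂
  have hm := RiddledBasin.measurePreserving_flip
  obtain ⟨h10, h11⟩ := h₁
  obtain ⟨h20, h21⟩ := h₂
  have ha : 0 < 1 - β₁ := by linarith
  rw [← RiddledBasin.flip_preimage_bottomSide]
  refine ⟨fun h => ?_, fun h => ?_, fun _ h => ?_, fun _ h => ?_⟩
  · have hlt : (1 - β₁) * (1 + β₂) < 1 := by
      rcases h with h | ⟨-, h⟩
      · nlinarith
      · rwa [lt_sub_iff_add_lt', lt_div_iff₀' ha] at h
    have hr := RiddledBasin.hasLocallyRiddledBasin_bottomSide (h₁ := ⟨h10, h11⟩)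
      (h₂ := ⟨h20, h21⟩) hlt
    exact ⟨hr.isMilnorAttractor, RiddledBasin.isEssentialAttractor_bottomSide hlt, hr⟩
  -- For the reflected parameters the product of the multipliers is `β₁ * (2 - β₂)`.
  · have hlt : (1 - (1 - β₁)) * (1 + (1 - β₂)) < 1 := by
      rcases h with h | ⟨-, h⟩
      · nlinarith
      · rw [sub_lt_comm, lt_div_iff₀' h10] at h
        linarith
    have hr := (RiddledBasin.hasLocallyRiddledBasin_bottomSide hlt).conj hs hm
    exact ⟨hr.isMilnorAttractor, (RiddledBasin.isEssentialAttractor_bottomSide hlt).conj hs hm, hr⟩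
  · rw [sub_lt_iff_lt_add', div_lt_iff₀' ha] at h
    exact RiddledBasin.isChaoticSaddle_bottomSide h
  · have hlt : 1 < (1 - (1 - β₁)) * (1 + (1 - β₂)) := by
      rw [lt_sub_comm, div_lt_iff₀' h10] at h
      linarith
    exact (RiddledBasin.isChaoticSaddle_bottomSide hlt).conj hs hm
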